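/- **Notation.** Let $p_0\ge 2$ and $p_1,\dots,p_{p_0}\ge 2$ be integers; clouds are the pairs $(x,i)$ with $x\in[p_0]$, $i\in[p_x]$. Let $n_{x,i},k_{x,i},\delta_{x,i},\gamma_x$ be positive integers such that $r_{x,i}=n_{x,i}-k_{x,i}>0$ and $2\gamma_x<\min_i(r_{x,i}-\delta_{x,i})$. Put $\delta_x=\sum_i\delta_{x,i}$ and $\gamma=\sum_x p_x\gamma_x$. **Construction.** Let $\mathrm{GF}(q)$ be a finite field with $q\ge\max_{x,i}\{n_{x,i}+\delta_x-(p_x-2)\gamma_x+\gamma\}$. For each cloud let $u_{x,i}=k_{x,i}+\delta_{x,i}+2\gamma_x$, $v_{x,i}=r_{x,i}-\delta_{x,i}+\delta_x-p_x\gamma_x+\gamma$, let $a_{x,i,1},\dots,a_{x,i,u_{x,i}},b_{x,i,1},\dots,b_{x,i,v_{x,i}}$ be distinct elements of $\mathrm{GF}(q)$, and let $T_{x,i}=\big(1/(a_{x,i,s}-b_{x,i,t})\big)_{s,t}$ be the corresponding Cauchy matrix. Partition its rows into three parts of sizes $k_{x,i},\delta_{x,i},2\gamma_x$ and its columns into parts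 of sizes $r_{x,i}$; $\delta_{x,i'}$ for each $i'\in[p_x]\setminus\{i\}$; and $\gamma_y$ for each pair $(y,j)$ with $y\ne x$, $j\in[p_y]$. In the first row part the blocks are called $A_{x,x;i,i}$, $B_{x,x;i,i'}$, $E_{x,y;i;j}$ respectively; the blocks of the second and third row parts in the first $r_{x,i}$ columns are called $U_{x,i}$ and $V_{x,i}$. Put $A_{x,x;i,i'}=B_{x,x;i,i'}U_{x,i'}$ for $i'\neq i$, and $A_{x,y;i,j}=[E_{x,y;i;j},E_{x,y;i;j+1}]V_{y,j}$ for $y\ne x$, where $E_{x,y;i;p_y+1}=E_{x,y;i;1}$. Let $\mathcal C_2$ be the set of all words $c=(c_{y,j})_{y,j}$ with $$c_{y,j}=\Big[m_{y,j},\ \sum_{x,i}m_{x,i}A_{x,y;i,j}\Big]\in\mathrm{GF}(q)^{n_{y,j}},$$ where the messages $m_{x,i}\in\mathrm{GF}(q)^{k_{x,i}}$ are arbitrary. **Distances.** Put $$d_{1,x,i}=r_{x,i}-\delta_{x,i}-2\gamma_x+1,\quad d_{2,x,i}=r_{x,i}-\delta_{x,i}+\delta_x+1,\quad d_{3,x,i}=r_{x,i}-\delta_{x,i}+\delta_x-p_x\gamma_x+\gamma+1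 .$$ **Component codes.** For a cloud $(x,i)$ let the local code be $\{c_{x,i}:c\in\mathcal C_2\}$, the middle code $\{c_{x,i}:c\in\mathcal C_2,\ c_{x,i'}=0\ \forall i'\ne i\}$, and the global code $\{c_{x,i}:c\in\mathcal C_2,\ c_{y,j}=0\ \forall (y,j)\neq(x,i)\}$. **Theorem.** Elements $a_{x,i,s},b_{x,i,t}$ as required exist, and for every choice of them the following holds. 1. For every cloud $(x,i)$, distinct words of its local, middle and global code have Hamming distance at least $d_{1,x,i}$, $d_{2,x,i}$ and $d_{3,x,i}$, respectively. 2. If moreover $d_{3,x,i}\le n_{x,i}$ for all $(x,i)$ (without which no code of length $n_{x,i}$ has minimum distance $d_{3,x,i}$), then $\mathcal C_2$ is a linear code with hierarchical locality with block lengths $n_{x,i}$, message lengths $k_{x,i}$ and distances $d_{1,x,i}<d_{2,x,i}<d_{3,x,i}$. That is: $k_{x,i}<n_{x,i}$; each block $c_{x,i}$ of a codeword determines, linearly, a message $m_{x,i}\in\mathrm{GF}(q)^{k_{x,i}}$; each choice of the messages of all clouds comes from exactly one codeword; and for every cloud the minimum distances of the local, middle and global code are exactly $d_{1,x,i}$,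 $d_{2,x,i}$ and $d_{3,x,i}$. The dimensions of these three codes are $n_{x,i}-d_{l,x,i}+1$ for $l=1,2,3$, respectively. -/

import Mathlib

/-! ### Block codes with two and three levels of access -/

namespace HierCode

variable {F : Type*} [Field F] [DecidableEq F]

/-- Any two distinct words of `C` have Hamming distance at least `d`
(equivalently, `C` corrects any `d - 1` erasures). -/
def MinDistGE {n : ℕ} (C : Submodule F (Fin n → F)) (d : ℕ) : Prop :=
  ∀ c₁ ∈ C, ∀ c₂ ∈ C, c₁ ≠ c₂ → d ≤ hammingDist c₁ c₂

/-- The minimum distance of `C` is exactly `d`: the least Hamming distance between two distinct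
words of `C` exists and equals `d`. -/
def HasMinDist {n : ℕ} (C : Submodule F (Fin n → F)) (d : ℕ) : Prop :=
  IsLeast {w : ℕ | ∃ c₁ ∈ C, ∃ c₂ ∈ C, c₁ ≠ c₂ ∧ hammingDist c₁ c₂ = w} d

/-- Words consisting of `p` blocks, the `i`-th of length `n i`. -/
abbrev Word (F : Type*) {p : ℕ} (n : Fin p → ℕ) : Type _ :=
  (i : Fin p) → Fin (n i) → F

/-- The projection of a code to its `i`-th block. -/
def localCode {p : ℕ} {n : Fin p → ℕ} (C : Submodule F (Word F n)) (i : Fin p) :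
    Submodule F (Fin (n i) → F) :=
  C.map (LinearMap.proj i)

/-- The `i`-th blocks of those words of a code whose other blocks all vanish. -/
def shortCode {p : ℕ} {n : Fin p → ℕ} (C : Submodule F (Word F n)) (i : Fin p) :
    Submodule F (Fin (n i) → F) :=
  (C ⊓ Submodule.pi {j | j ≠ i} fun _ => ⊥).map (LinearMap.proj i)

/-- A code with double-level access: `n i` is the length of the `i`-th block, `k i` the length of
the message carried by it, `D 0 i` the local and `D 1 i` the global distance. -/
structure IsDoubleLevelCode {p : ℕ} (n k : Fin p → ℕ) (D : Fin 2 → Fin p → ℕ)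
    (C : Submodule F (Word F n)) : Prop where
  k_lt_n : ∀ i, k i < n i
  D_lt : ∀ i, D 0 i < D 1 i
  /-- The `i`-th block determines, linearly, a message of `k i` symbols, and these messages can be
  prescribed arbitrarily and simultaneously. -/
  message : ∃ μ : (i : Fin p) → (Fin (n i) → F) →ₗ[F] (Fin (k i) → F),
    ∀ m : Word F k, ∃ c ∈ C, ∀ i, μ i (c i) = m i
  local_dist : ∀ i, HasMinDist (localCode C i) (D 0 i)
  global_dist : ∀ i, HasMinDist (shortCode C i) (D 1 i)

/-- Words consisting of `p₀` groups of blocks; the `x`-th group has `p x` blocks, the `i`-th of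
them of length `n x i`. -/
abbrev HWord (F : Type*) {p₀ : ℕ} {p : Fin p₀ → ℕ} (n : (x : Fin p₀) → Fin (p x) → ℕ) : Type _ :=
  (x : Fin p₀) → Word F (n x)

section ThreeLevels

variable {p₀ : ℕ} {p : Fin p₀ → ℕ} {n : (x : Fin p₀) → Fin (p x) → ℕ}

/-- The projection of a code to its `x`-th group of blocks. -/
def groupCode (C : Submodule F (HWord F n)) (x : Fin p₀) : Submodule F (Word F (n x)) :=
  C.map (LinearMap.proj x)

/-- The blocks `(x, i)` of those words of a code whose other blocks, in all groups, vanish. -/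
def globalCode (C : Submodule F (HWord F n)) (x : Fin p₀) (i : Fin (p x)) :
    Submodule F (Fin (n x i) → F) where
  carrier := {v | ∃ c ∈ C, (∀ (y : Fin p₀) (j : Fin (p y)),
    (⟨x, i⟩ : Σ x, Fin (p x)) ≠ ⟨y, j⟩ → c y j = 0) ∧ c x i = v}
  zero_mem' := ⟨0, C.zero_mem, fun _ _ _ => rfl, rfl⟩
  add_mem' := by
    rintro _ _ ⟨c, hc, hc0, rfl⟩ ⟨d, hd, hd0, rfl⟩
    exact ⟨c + d, C.add_mem hc hd, fun y j h => by simp [hc0 y j h, hd0 y j h], rfl⟩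
  smul_mem' := by
    rintro a _ ⟨c, hc, hc0, rfl⟩
    exact ⟨a • c, C.smul_mem a hc, fun y j h => by simp [hc0 y j h], rfl⟩

/-- A code with hierarchical locality (three levels of access): `n x i` is the length of the block
`(x, i)`, `k x i` the length of the message carried by it, and `D 0 x i`, `D 1 x i`, `D 2 x i` are
its local, middle and global distances. -/
structure IsHierarchicalCode (n k : (x : Fin p₀) → Fin (p x) → ℕ)
    (D : Fin 3 → (x : Fin p₀) → Fin (p x) → ℕ) (C : Submodule F (HWord F n)) : Prop where
  D_lt₁ : ∀ x i, D 0 x i < D 1 x i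
  D_lt₂ : ∀ x i, D 1 x i < D 2 x i
  /-- Each block determines, linearly, its message, and a codeword is the same thing as an
  arbitrary choice of the messages of all blocks. -/
  message : ∃ μ : (x : Fin p₀) → (i : Fin (p x)) → (Fin (n x i) → F) →ₗ[F] (Fin (k x i) → F),
    ∀ m : HWord F k, ∃! c : HWord F n, c ∈ C ∧ ∀ x i, μ x i (c x i) = m x i
  group : ∀ x, IsDoubleLevelCode (n x) (k x) ![D 0 x, D 1 x] (groupCode C x)
  global_dist : ∀ x i, HasMinDist (globalCode C x i) (D 2 x i)

end ThreeLevels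

/-! ### The construction from partitioned Cauchy matrices -/

/-- The numerical data of the construction. -/
structure Params where
  /-- the number of groups -/
  p₀ : ℕ
  /-- the number of local clouds of each group -/
  p : Fin p₀ → ℕ
  n : (x : Fin p₀) → Fin (p x) → ℕ
  k : (x : Fin p₀) → Fin (p x) → ℕ
  δ : (x : Fin p₀) → Fin (p x) → ℕ
  γ : Fin p₀ → ℕ

namespace Params

variable (P : Params)

/-- `r_{x,i} = n_{x,i} - k_{x,i}` -/
def r (x : Fin P.p₀) (i : Fin (P.p x)) : ℕ := P.n x i - P.k x i

/-- `δ_x = δ_{x,1} + ⋯ + δ_{x,p_x}` -/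
def δsum (x : Fin P.p₀) : ℕ := ∑ i, P.δ x i

/-- `γ = ∑_x p_x γ_x` -/
def γsum : ℕ := ∑ x, P.p x * P.γ x

/-- The conditions on the parameters: all of them are positive integers, there are at least two
groups and at least two clouds in each group, `n_{x,i} > k_{x,i}`, and
`2γ_x < r_{x,i} - δ_{x,i}`. -/
structure Admissible : Prop where
  two_le_p₀ : 2 ≤ P.p₀
  two_le_p : ∀ x, 2 ≤ P.p x
  k_pos : ∀ x i, 0 < P.k x i
  δ_pos : ∀ x i, 0 < P.δ x i
  γ_pos : ∀ x, 0 < P.γ x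
  k_lt_n : ∀ x i, P.k x i < P.n x i
  two_γ_lt : ∀ x i, 2 * P.γ x < P.r x i - P.δ x i

/-- `d_{1,x,i} = r_{x,i} - δ_{x,i} - 2γ_x + 1` -/
def d₁ (x : Fin P.p₀) (i : Fin (P.p x)) : ℕ := P.r x i - P.δ x i - 2 * P.γ x + 1

/-- `d_{2,x,i} = r_{x,i} - δ_{x,i} + δ_x + 1` -/
def d₂ (x : Fin P.p₀) (i : Fin (P.p x)) : ℕ := P.r x i - P.δ x i + P.δsum x + 1

/-- `d_{3,x,i} = r_{x,i} - δ_{x,i} + δ_x - p_x γ_x + γ + 1`; the summand `γ` is put before the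
subtraction, which is then a true one because `p_x γ_x ≤ γ`. -/
def d₃ (x : Fin P.p₀) (i : Fin (P.p x)) : ℕ :=
  P.r x i - P.δ x i + P.δsum x + P.γsum - P.p x * P.γ x + 1

/-- Row indices of `T_{x,i}`: `k_{x,i}` rows for `A, B, E`, then `δ_{x,i}` rows for `U`, then
`2γ_x` rows for `V`. -/
abbrev Row (x : Fin P.p₀) (i : Fin (P.p x)) : Type :=
  Fin (P.k x i) ⊕ (Fin (P.δ x i) ⊕ (Fin (P.γ x) ⊕ Fin (P.γ x)))

/-- Column indices of `T_{x,i}`: `r_{x,i}` columns for `A, U, V`, then `δ_{x,i'}` columns for each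
`B_{x,x;i,i'}` with `i' ≠ i`, then `γ_y` columns for each `E_{x,y;i;j}` with `y ≠ x`. -/
abbrev Col (x : Fin P.p₀) (i : Fin (P.p x)) : Type :=
  Fin (P.r x i) ⊕ ((Σ i' : {i' : Fin (P.p x) // i' ≠ i}, Fin (P.δ x i'.1)) ⊕
    (Σ y : {y : Fin P.p₀ // y ≠ x}, Fin (P.p y.1) × Fin (P.γ y.1)))

/-- For every cloud, points `a_{x,i,s}`, `b_{x,i,t}` of `F` that are pairwise distinct, one for each
row and one for each column of `T_{x,i}`. -/
structure CauchyPoints (F : Type*) where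
  a : (x : Fin P.p₀) → (i : Fin (P.p x)) → P.Row x i → F
  b : (x : Fin P.p₀) → (i : Fin (P.p x)) → P.Col x i → F
  distinct : ∀ x i, Function.Injective (Sum.elim (a x i) (b x i))

end Params

namespace Params.CauchyPoints

variable {P : Params} (S : P.CauchyPoints F)

/-- The Cauchy matrix `T_{x,i}`. -/
def T (x : Fin P.p₀) (i : Fin (P.p x)) : Matrix (P.Row x i) (P.Col x i) F :=
  Matrix.of fun s t => 1 / (S.a x i s - S.b x i t)

/-- `A_{x,x;i,i}` -/
def A (x : Fin P.p₀) (i : Fin (P.p x)) : Matrix (Fin (P.k x i)) (Fin (P.r x i)) F :=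
  (S.T x i).submatrix Sum.inl Sum.inl

/-- `B_{x,x;i,i'}`, for `i' ≠ i` -/
def B (x : Fin P.p₀) (i i' : Fin (P.p x)) (h : i' ≠ i) :
    Matrix (Fin (P.k x i)) (Fin (P.δ x i')) F :=
  (S.T x i).submatrix Sum.inl fun t => Sum.inr (Sum.inl ⟨⟨i', h⟩, t⟩)

/-- `E_{x,y;i;j}`, for `y ≠ x` -/
def E (x y : Fin P.p₀) (i : Fin (P.p x)) (j : Fin (P.p y)) (h : y ≠ x) :
    Matrix (Fin (P.k x i)) (Fin (P.γ y)) F :=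
  (S.T x i).submatrix Sum.inl fun t => Sum.inr (Sum.inr ⟨⟨y, h⟩, (j, t)⟩)

/-- `U_{x,i}` -/
def U (x : Fin P.p₀) (i : Fin (P.p x)) : Matrix (Fin (P.δ x i)) (Fin (P.r x i)) F :=
  (S.T x i).submatrix (fun s => Sum.inr (Sum.inl s)) Sum.inl

/-- `V_{x,i}` -/
def V (x : Fin P.p₀) (i : Fin (P.p x)) : Matrix (Fin (P.γ x) ⊕ Fin (P.γ x)) (Fin (P.r x i)) F :=
  (S.T x i).submatrix (fun s => Sum.inr (Sum.inr s)) Sum.inl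

/-- The matrix `A_{x,x;i,i'}`: a block of the Cauchy matrix if `i' = i`, and
`B_{x,x;i,i'} U_{x,i'}` otherwise. -/
def sameGroup (x : Fin P.p₀) (i i' : Fin (P.p x)) :
    Matrix (Fin (P.k x i)) (Fin (P.r x i')) F :=
  if h : i' = i then (S.A x i).submatrix id (Fin.cast (congrArg (P.r x) h))
  else S.B x i i' h * S.U x i'

/-- The matrix `A_{x,y;i,j} = [E_{x,y;i;j}, E_{x,y;i;j+1}] V_{y,j}` for `y ≠ x`, with
`E_{x,y;i;p_y+1} = E_{x,y;i;1}`; here `finRotate` is the cyclic successor. -/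
def crossGroup (x y : Fin P.p₀) (i : Fin (P.p x)) (j : Fin (P.p y)) (h : y ≠ x) :
    Matrix (Fin (P.k x i)) (Fin (P.r y j)) F :=
  Matrix.fromCols (S.E x y i j h) (S.E x y i (finRotate (P.p y) j) h) * S.V y j

/-- The matrix `A_{x,y;i,j}`, for all pairs of clouds. -/
def parity (x y : Fin P.p₀) (i : Fin (P.p x)) (j : Fin (P.p y)) :
    Matrix (Fin (P.k x i)) (Fin (P.r y j)) F :=
  if h : y = x then
    match y, h, j with
    | _, rfl, j => S.sameGroup _ i j
  else S.crossGroup x y i j h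

/-- The generator matrix: in the columns of the cloud `(y, j)`, the block of rows `(x, i)` is
`[I, A_{y,y;j,j}]` if `(x, i) = (y, j)` and `[0, A_{x,y;i,j}]` otherwise. -/
def G : Matrix (Σ x : Fin P.p₀, Σ i : Fin (P.p x), Fin (P.k x i))
    (Σ y : Fin P.p₀, Σ j : Fin (P.p y), Fin (P.n y j)) F :=
  Matrix.of fun s t =>
    if h : t.2.2.1 < P.k t.1 t.2.1 then
      if s = ⟨t.1, t.2.1, ⟨t.2.2.1, h⟩⟩ then 1 else 0
    else
      S.parity s.1 t.1 s.2.1 t.2.1 s.2.2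
        ⟨t.2.2.1 - P.k t.1 t.2.1, Nat.sub_lt_sub_right (not_lt.mp h) t.2.2.2⟩

/-- The code with generator matrix `G`, its words being cut into blocks. -/
def code : Submodule F (HWord F P.n) where
  carrier := {c | ∃ m : (Σ x : Fin P.p₀, Σ i : Fin (P.p x), Fin (P.k x i)) → F,
    ∀ y j t, c y j t = Matrix.vecMul m S.G ⟨y, j, t⟩}
  zero_mem' := ⟨0, fun y j t => by simp⟩
  add_mem' := by
    rintro _ _ ⟨m, hm⟩ ⟨m', hm'⟩
    exact ⟨m + m', fun y j t => by simp [hm, hm', Matrix.add_vecMul]⟩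
  smul_mem' := by
    rintro a _ ⟨m, hm⟩
    exact ⟨a • m, fun y j t => by simp [hm, Matrix.smul_vecMul]⟩

end Params.CauchyPoints

end HierCode

/-! Each block of a codeword is a systematic word of its cloud: the message `m` followed by the
first `r` entries of `v T`, where `T` is the Cauchy matrix of the cloud and `v` consists of `m`, of
a syndrome `σ` that the other clouds of the group contribute, and of two syndromes `ε_i`, `ε_{i+1}`
that the other groups contribute (`mem_code`). Everything rests on one property of Cauchy matrices
(`card_zeros_lt_card_support`): a nonzero combination of rows has fewer zeros than it has nonzero
coefficients.

The three component codes are obtained from `v` by freeing a set `R` of rows below the message and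
forcing the parities to vanish on a set `Z` of columns beyond the first `r` (`constraintSpace`):

* for the local code, `σ` and both `ε` are free and nothing is forced (`localCode_eq`);
* if the other blocks of the group vanish, then so do their `σ` and `ε`; as the vectors `ε` are
  shared cyclically, the cloud itself then has no `ε` left, and the vanishing of the other `σ` says
  that the parities of `m` on the columns of the `B` are zero (`shortCode_eq`);
* if all other blocks vanish, the parities on the columns of the `E` are zero too
  (`globalCode_eq`).

The Cauchy property gives such a code distance at least `r + |Z| + 1 - |R|`, counting equations
gives dimension at least `k + |R| - |Z|`, and the Singleton bound makes both exact
(`exact_systematicWord`). Only the description of the local code uses `d₃ ≤ n`: it makes the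
messages of the other clouds long enough for `σ` and the two `ε` to take all values. -/

namespace HierCode

/-! ### Cauchy matrices -/

section Cauchy

variable {F ι κ : Type*} [Field F] [DecidableEq F] [Fintype ι] [Fintype κ]

/-- A nonzero combination `v` of the rows of a Cauchy matrix has fewer zeros than `v` has nonzero
coefficients: after clearing denominators, the combination is a nonzero polynomial of degree less
than the size of the support of `v`, evaluated at the column points. -/
theorem card_zeros_lt_card_support (a : ι → F) (b : κ → F)
    (hab : Function.Injective (Sum.elim a b)) {v : ι → F} (hv : v ≠ 0) :
    (Finset.univ.filter fun t => ∑ s, v s * (1 / (a s - b t)) = 0).card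
      < (Finset.univ.filter fun s => v s ≠ 0).card := by
  classical
  have ha : Function.Injective a := fun s s' h => Sum.inl_injective (hab h)
  have hb : Function.Injective b := fun s s' h => Sum.inr_injective (hab h)
  have hne : ∀ s t, b t - a s ≠ 0 := fun s t h =>
    Sum.inr_ne_inl (hab (show Sum.elim a b (Sum.inr t) = Sum.elim a b (Sum.inl s) from
      sub_eq_zero.mp h))
  set I := Finset.univ.filter fun s => v s ≠ 0 with hI
  obtain ⟨s₀, hs₀⟩ := Function.ne_iff.mp hv
  have hs₀I : s₀ ∈ I := by simpa [hI] using hs₀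
  let f : Polynomial F := ∑ s ∈ I, Polynomial.C (v s) *
    ∏ s' ∈ I.erase s, (Polynomial.X - Polynomial.C (a s'))
  have hf : f ≠ 0 := by
    intro h
    have h₀ : f.eval (a s₀) = v s₀ * ∏ s' ∈ I.erase s₀, (a s₀ - a s') := by
      simp only [f, Polynomial.eval_finsetSum, Polynomial.eval_mul, Polynomial.eval_C,
        Polynomial.eval_prod, Polynomial.eval_sub, Polynomial.eval_X]
      refine Finset.sum_eq_single_of_mem s₀ hs₀I fun s _ hs => ?_
      rw [Finset.prod_eq_zero (Finset.mem_erase.mpr ⟨hs.symm, hs₀I⟩) (sub_self _), mul_zero]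
    rw [h, Polynomial.eval_zero, eq_comm, mul_eq_zero, Finset.prod_eq_zero_iff] at h₀
    rcases h₀ with h₀ | ⟨s, hs, h₀⟩
    · exact hs₀ h₀
    · exact Finset.ne_of_mem_erase hs (ha (sub_eq_zero.mp h₀)).symm
  have hdeg : f.degree < I.card := by
    refine lt_of_le_of_lt (Polynomial.degree_sum_le _ _) ?_
    rw [Finset.sup_lt_iff (WithBot.bot_lt_coe _)]
    intro s hs
    have hvs : v s ≠ 0 := by simpa [hI] using hs
    rw [Polynomial.degree_C_mul hvs, Polynomial.degree_prod]
    simp only [Polynomial.degree_X_sub_C, Finset.sum_const, Finset.card_erase_of_mem hs,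
      nsmul_eq_mul, mul_one]
    exact_mod_cast Nat.sub_lt (Finset.card_pos.mpr ⟨s, hs⟩) one_pos
  by_contra! hle
  refine hf (Polynomial.eq_zero_of_degree_lt_of_eval_finset_eq_zero
    ((Finset.univ.filter fun t => ∑ s, v s * (1 / (a s - b t)) = 0).image b) ?_ ?_)
  · rw [Finset.card_image_of_injective _ hb]
    exact hdeg.trans_le (by exact_mod_cast hle)
  · intro x hx
    obtain ⟨t, ht, rfl⟩ := Finset.mem_image.mp hx
    have ht : ∑ s, v s * (1 / (a s - b t)) = 0 := (Finset.mem_filter.mp ht).2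
    have hsum : ∑ s ∈ I, v s * (1 / (a s - b t)) = 0 := by
      rw [← ht]
      refine Finset.sum_subset (Finset.subset_univ _) fun s _ hs => ?_
      have : v s = 0 := by simpa [hI] using hs
      rw [this, zero_mul]
    have : f.eval (b t) = -(∏ s ∈ I, (b t - a s)) * ∑ s ∈ I, v s * (1 / (a s - b t)) := by
      simp only [f, Polynomial.eval_finsetSum, Polynomial.eval_mul, Polynomial.eval_C,
        Polynomial.eval_prod, Polynomial.eval_sub, Polynomial.eval_X, Finset.mul_sum]
      refine Finset.sum_congr rfl fun s hs => ?_
      rw [← Finset.mul_prod_erase I _ hs, ← neg_sub (b t) (a s)]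
      have := hne s t
      field_simp
    rw [this, hsum, mul_zero]

/-- The rows of a Cauchy matrix with at least as many rows as columns span everything. -/
theorem exists_sum_cauchy_eq (a : ι → F) (b : κ → F)
    (hab : Function.Injective (Sum.elim a b)) (hc : Fintype.card κ ≤ Fintype.card ι)
    (w : κ → F) : ∃ v : ι → F, ∀ t, ∑ s, v s * (1 / (a s - b t)) = w t := by
  classical
  obtain ⟨f⟩ := Function.Embedding.nonempty_of_card_le hc
  let φ : (κ → F) →ₗ[F] (κ → F) :=
    Matrix.vecMulLinear (Matrix.of fun s t => 1 / (a (f s) - b t))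
  have hφ : ∀ v t, φ v t = ∑ s, v s * (1 / (a (f s) - b t)) := fun v t => rfl
  have hinj : Function.Injective φ := by
    rw [injective_iff_map_eq_zero]
    intro v hv
    by_contra hne
    have hab' : Function.Injective (Sum.elim (a ∘ f) b) := by
      have := hab.comp (f.injective.sumMap (Function.injective_id (α := κ)))
      simpa [Sum.elim_comp_map] using this
    refine absurd (card_zeros_lt_card_support (a ∘ f) b hab' hne) (not_lt.mpr ?_)
    rw [Finset.filter_true_of_mem (p := fun t => ∑ s, v s * (1 / ((a ∘ f) s - b t)) = 0)
      fun t _ => (hφ v t).symm.trans (congrFun hv t)]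
    exact Finset.card_le_card (Finset.filter_subset _ _)
  obtain ⟨u, hu⟩ := (LinearMap.injective_iff_surjective.mp hinj) w
  refine ⟨Function.extend f u 0, fun t => ?_⟩
  rw [← hu, hφ]
  refine (Fintype.sum_of_injective f f.injective _ _ (fun s hs => ?_) fun s => ?_).symm
  · rw [Function.extend_apply' _ _ _ (by simpa using hs), Pi.zero_apply, zero_mul]
  · rw [f.injective.extend_apply]

end Cauchy

/-! ### The Singleton bound -/

section Singleton

variable {F : Type*} [Field F] [DecidableEq F] {n : ℕ}

theorem minDistGE_of_hammingNorm {C : Submodule F (Fin n → F)} {d : ℕ}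
    (h : ∀ c ∈ C, c ≠ 0 → d ≤ hammingNorm c) : MinDistGE C d := fun c₁ h₁ c₂ h₂ hne => by
  rw [hammingDist_eq_hammingNorm]
  exact h _ (by simpa [sub_eq_add_neg, add_comm] using C.sub_mem h₂ h₁) (by
    simpa [sub_eq_zero, neg_add_eq_zero] using hne)

theorem MinDistGE.mono {C C' : Submodule F (Fin n → F)} {d : ℕ} (h : MinDistGE C' d)
    (hC : C ≤ C') : MinDistGE C d :=
  fun c₁ h₁ c₂ h₂ => h c₁ (hC h₁) c₂ (hC h₂)

/-- A code of dimension `s + 1` has a nonzero word that vanishes on the first `s` coordinates. -/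
theorem exists_hammingNorm_add_finrank_le {C : Submodule F (Fin n → F)}
    (hC : 0 < Module.finrank F C) :
    ∃ c ∈ C, c ≠ 0 ∧ hammingNorm c + Module.finrank F C ≤ n + 1 := by
  obtain ⟨s, hs⟩ := Nat.exists_eq_succ_of_ne_zero hC.ne'
  have hsn : s < n := by
    have := Submodule.finrank_le C
    rw [Module.finrank_fin_fun] at this
    omega
  let φ : C →ₗ[F] (Fin s → F) :=
    (LinearMap.funLeft F F (Fin.castLE hsn.le)).comp C.subtype
  obtain ⟨c, hc, hc0⟩ := Submodule.exists_mem_ne_zero_of_ne_bot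
    (LinearMap.ker_ne_bot_of_finrank_lt (f := φ) (by rw [Module.finrank_fin_fun, hs]; omega))
  refine ⟨c, c.2, by simpa using hc0, ?_⟩
  have hzero : ∀ t : Fin n, t.1 < s → c.1 t = 0 := fun t ht =>
    congrFun (LinearMap.mem_ker.mp hc) ⟨t.1, ht⟩
  have : hammingNorm c.1 ≤ (Finset.univ.filter fun t : Fin n => ¬ t.1 < s).card :=
    Finset.card_le_card fun t ht => by
      simp only [Finset.mem_filter, Finset.mem_univ, true_and] at ht ⊢
      exact fun h => ht (hzero t h)
  have h₂ := Finset.card_filter_add_card_filter_not (s := (Finset.univ : Finset (Fin n)))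
    (fun t => t.1 < s)
  have h₃ : (Finset.univ.filter fun t : Fin n => t.1 < s).card = s := by
    rw [Fin.card_filter_val_lt]; omega
  rw [Finset.card_univ, Fintype.card_fin] at h₂
  omega

/-- A code that meets the Singleton bound has exactly the distance and dimension it predicts. -/
theorem MinDistGE.exact {C : Submodule F (Fin n → F)} {d : ℕ} (h : MinDistGE C d) (hd : d ≤ n)
    (hdim : n + 1 ≤ Module.finrank F C + d) :
    HasMinDist C d ∧ Module.finrank F C = n - d + 1 := by
  obtain ⟨c, hc, hc0, hle⟩ := exists_hammingNorm_add_finrank_le (C := C) (by omega)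
  have hge := h c hc 0 C.zero_mem hc0
  rw [hammingDist_zero_right] at hge
  refine ⟨⟨⟨c, hc, 0, C.zero_mem, hc0, ?_⟩, ?_⟩, by omega⟩
  · rw [hammingDist_zero_right]; omega
  · rintro _ ⟨c₁, h₁, c₂, h₂, hne, rfl⟩
    exact h c₁ h₁ c₂ h₂ hne

end Singleton

/-! ### Systematic words with parities from a partitioned matrix -/

section Systematic

variable {F ρ κ : Type*} [Field F] {n k r : ℕ} [Fintype ρ]

/-- The word of length `n` that consists of the first `k` entries of `v` and the first `r = n - k`
entries of `v T`. -/
def systematicWord (hr : r = n - k) (T : Matrix (Fin k ⊕ ρ) (Fin r ⊕ κ) F) :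
    (Fin k ⊕ ρ → F) →ₗ[F] (Fin n → F) where
  toFun v t := if h : t.1 < k then v (Sum.inl ⟨t.1, h⟩)
    else ∑ s, v s * T s (Sum.inl ⟨t.1 - k, hr ▸ Nat.sub_lt_sub_right (not_lt.mp h) t.2⟩)
  map_add' v w := by
    ext t
    by_cases h : t.1 < k <;> simp [h, add_mul, Finset.sum_add_distrib]
  map_smul' a v := by
    ext t
    by_cases h : t.1 < k <;> simp [h, mul_assoc, Finset.mul_sum, mul_add]

variable (hr : r = n - k) (T : Matrix (Fin k ⊕ ρ) (Fin r ⊕ κ) F)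

theorem systematicWord_of_lt (v : Fin k ⊕ ρ → F) (t : Fin n) (h : t.1 < k) :
    systematicWord hr T v t = v (Sum.inl ⟨t.1, h⟩) := dif_pos h

theorem systematicWord_of_not_lt (v : Fin k ⊕ ρ → F) (t : Fin n) (h : ¬ t.1 < k) :
    systematicWord hr T v t =
      ∑ s, v s * T s (Sum.inl ⟨t.1 - k, hr ▸ Nat.sub_lt_sub_right (not_lt.mp h) t.2⟩) := dif_neg h

theorem hammingNorm_systematicWord [DecidableEq F] (hkn : k ≤ n) (v : Fin k ⊕ ρ → F) :
    hammingNorm (systematicWord hr T v) =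
      (Finset.univ.filter fun s : Fin k => v (Sum.inl s) ≠ 0).card +
      (Finset.univ.filter fun t : Fin r => ∑ s, v s * T s (Sum.inl t) ≠ 0).card := by
  let e : Fin k ⊕ Fin r ≃ Fin n :=
    finSumFinEquiv.trans (finCongr (by omega : k + r = n))
  have h₁ : ∀ s, systematicWord hr T v (e (Sum.inl s)) = v (Sum.inl s) := fun s =>
    systematicWord_of_lt hr T v _ (by simp [e])
  have h₂ : ∀ t, systematicWord hr T v (e (Sum.inr t)) = ∑ s, v s * T s (Sum.inl t) := fun t => by
    rw [systematicWord_of_not_lt hr T v _ (by simp [e])]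
    simp [e]
  rw [hammingNorm, Finset.card_filter, Finset.card_filter, Finset.card_filter, ← e.sum_comp,
    Fintype.sum_sum_type]
  simp only [h₁, h₂]

/-- The coefficient vectors that vanish on the last rows outside `R` and whose parities vanish
on the last columns in `Z`. -/
def constraintSpace (R : Finset ρ) (Z : Finset κ) : Submodule F (Fin k ⊕ ρ → F) where
  carrier := {v | (∀ s ∉ R, v (Sum.inr s) = 0) ∧ ∀ t ∈ Z, ∑ s, v s * T s (Sum.inr t) = 0}
  zero_mem' := by simp
  add_mem' := by
    rintro v w ⟨hv, hv'⟩ ⟨hw, hw'⟩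
    exact ⟨fun s hs => by simp [hv s hs, hw s hs], fun t ht => by
      simp [add_mul, Finset.sum_add_distrib, hv' t ht, hw' t ht]⟩
  smul_mem' := by
    rintro a v ⟨hv, hv'⟩
    exact ⟨fun s hs => by simp [hv s hs], fun t ht => by
      simp [mul_assoc, ← Finset.mul_sum, hv' t ht]⟩

theorem le_finrank_constraintSpace (R : Finset ρ) (Z : Finset κ) :
    k + R.card ≤ Module.finrank F (constraintSpace T R Z) + Z.card := by
  classical
  let φ : (Fin k ⊕ ρ → F) →ₗ[F] ({s // s ∈ Rᶜ} ⊕ {t // t ∈ Z} → F) :=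
    { toFun := fun v => Sum.elim (fun s => v (Sum.inr s.1))
        fun t => ∑ s, v s * T s (Sum.inr t.1)
      map_add' := fun v w => by
        ext (s | t) <;> simp [add_mul, Finset.sum_add_distrib]
      map_smul' := fun a v => by
        ext (s | t) <;> simp [mul_assoc, Finset.mul_sum, mul_add] }
  have hker : LinearMap.ker φ = constraintSpace T R Z := by
    ext v
    rw [LinearMap.mem_ker, funext_iff, Sum.forall]
    simp [φ, constraintSpace]
  have h₁ := LinearMap.finrank_range_add_finrank_ker φ
  have h₂ := Submodule.finrank_le (LinearMap.range φ)
  have h₃ := Finset.card_add_card_compl R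
  rw [hker] at h₁
  simp only [Module.finrank_fintype_fun_eq_card, Fintype.card_sum, Fintype.card_fin,
    Fintype.card_coe] at h₁ h₂
  omega

variable [Fintype κ] [DecidableEq F] {T} {a : Fin k ⊕ ρ → F} {b : Fin r ⊕ κ → F}

/-- The free rows in `R` cost distance, while the forced zeros in `Z` gain it, since they are among
the zeros that the Cauchy property bounds. -/
theorem card_lt_hammingNorm_systematicWord (hT : T = Matrix.of fun s t => 1 / (a s - b t))
    (hab : Function.Injective (Sum.elim a b)) (hkn : k ≤ n) {R : Finset ρ} {Z : Finset κ}
    {v : Fin k ⊕ ρ → F} (hv : v ∈ constraintSpace T R Z) (hv0 : v ≠ 0) :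
    r + Z.card < hammingNorm (systematicWord hr T v) + R.card := by
  have h := card_zeros_lt_card_support a b hab hv0
  have hT' : ∀ s t, T s t = 1 / (a s - b t) := fun s t => by rw [hT]; rfl
  simp only [← hT'] at h
  rw [Finset.card_filter, Finset.card_filter, Fintype.sum_sum_type, Fintype.sum_sum_type,
    ← Finset.card_filter, ← Finset.card_filter, ← Finset.card_filter, ← Finset.card_filter] at h
  have hR : (Finset.univ.filter fun s => v (Sum.inr s) ≠ 0).card ≤ R.card :=
    Finset.card_le_card fun s hs => by
      by_contra hsR
      exact (Finset.mem_filter.mp hs).2 (hv.1 s hsR)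
  have hZ : Z.card ≤ (Finset.univ.filter fun t => ∑ s, v s * T s (Sum.inr t) = 0).card :=
    Finset.card_le_card fun t ht => Finset.mem_filter.mpr ⟨Finset.mem_univ _, hv.2 t ht⟩
  have hc := Finset.card_filter_add_card_filter_not (s := (Finset.univ : Finset (Fin r)))
    (fun t => ∑ s, v s * T s (Sum.inl t) = 0)
  rw [Finset.card_univ, Fintype.card_fin] at hc
  rw [hammingNorm_systematicWord hr T hkn]
  simp only [← ne_eq] at hc
  omega

theorem systematicWord_injective (hT : T = Matrix.of fun s t => 1 / (a s - b t))
    (hab : Function.Injective (Sum.elim a b)) (hkn : k ≤ n) (hρ : Fintype.card ρ ≤ r) :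
    Function.Injective (systematicWord hr T) := by
  rw [injective_iff_map_eq_zero]
  intro v hv
  by_contra hv0
  have := card_lt_hammingNorm_systematicWord hr hT hab hkn (R := Finset.univ) (Z := ∅)
    (v := v) ⟨by simp, by simp⟩ hv0
  rw [hv, hammingNorm_zero, Finset.card_univ] at this
  omega

theorem minDistGE_systematicWord (hT : T = Matrix.of fun s t => 1 / (a s - b t))
    (hab : Function.Injective (Sum.elim a b)) (hkn : k ≤ n) (R : Finset ρ) (Z : Finset κ) {d : ℕ}
    (hd : d + R.card ≤ r + Z.card + 1) :
    MinDistGE ((constraintSpace T R Z).map (systematicWord hr T)) d := by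
  refine minDistGE_of_hammingNorm ?_
  rintro _ ⟨v, hv, rfl⟩ hne
  have := card_lt_hammingNorm_systematicWord hr hT hab hkn hv (by rintro rfl; simp at hne)
  omega

/-- The code cut out by `R` and `Z` attains the Singleton bound. -/
theorem exact_systematicWord (hT : T = Matrix.of fun s t => 1 / (a s - b t))
    (hab : Function.Injective (Sum.elim a b)) (hkn : k ≤ n) (hρ : Fintype.card ρ ≤ r)
    (R : Finset ρ) (Z : Finset κ) {d : ℕ} (hd : d + R.card = r + Z.card + 1) (hdn : d ≤ n) :
    HasMinDist ((constraintSpace T R Z).map (systematicWord hr T)) d ∧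
      Module.finrank F ((constraintSpace T R Z).map (systematicWord hr T)) = n - d + 1 := by
  refine (minDistGE_systematicWord hr hT hab hkn R Z hd.le).exact hdn ?_
  rw [← ((constraintSpace T R Z).equivMapOfInjective _
    (systematicWord_injective hr hT hab hkn hρ)).finrank_eq]
  have := le_finrank_constraintSpace T R Z
  omega

end Systematic

/-! ### Sizes of the Cauchy matrices -/

namespace Params

variable (P : Params)

theorem card_otherδ_add (x : Fin P.p₀) (i : Fin (P.p x)) :
    Fintype.card (Σ i' : {i' : Fin (P.p x) // i' ≠ i}, Fin (P.δ x i'.1)) + P.δ x i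
      = P.δsum x := by
  rw [Fintype.card_sigma, δsum, Fintype.sum_eq_add_sum_subtype_ne _ i, add_comm]
  simp only [Fintype.card_fin]

theorem card_otherγ_add (x : Fin P.p₀) :
    Fintype.card (Σ y : {y : Fin P.p₀ // y ≠ x}, Fin (P.p y.1) × Fin (P.γ y.1)) + P.p x * P.γ x
      = P.γsum := by
  rw [Fintype.card_sigma, γsum, Fintype.sum_eq_add_sum_subtype_ne _ x, add_comm]
  simp only [Fintype.card_fin, Fintype.card_prod]

theorem card_tailRow (x : Fin P.p₀) (i : Fin (P.p x)) :
    Fintype.card (Fin (P.δ x i) ⊕ (Fin (P.γ x) ⊕ Fin (P.γ x))) = P.δ x i + 2 * P.γ x := by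
  simp only [Fintype.card_sum, Fintype.card_fin]
  ring

variable {P}

theorem r_eq (x : Fin P.p₀) (i : Fin (P.p x)) : P.r x i = P.n x i - P.k x i := rfl

theorem Admissible.card_tailRow_le (hP : P.Admissible) (x : Fin P.p₀) (i : Fin (P.p x)) :
    Fintype.card (Fin (P.δ x i) ⊕ (Fin (P.γ x) ⊕ Fin (P.γ x))) ≤ P.r x i := by
  have := hP.two_γ_lt x i
  rw [card_tailRow]
  omega

theorem Admissible.finRotate_ne (hP : P.Admissible) (x : Fin P.p₀) (i : Fin (P.p x)) :
    finRotate (P.p x) i ≠ i := by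
  rw [← Equiv.Perm.mem_support, support_finRotate_of_le (hP.two_le_p x)]
  exact Finset.mem_univ i

theorem Admissible.exists_ne_cloud (hP : P.Admissible) (x : Fin P.p₀) (i : Fin (P.p x)) :
    ∃ i', i' ≠ i := ⟨_, hP.finRotate_ne x i⟩

theorem Admissible.exists_ne_group (hP : P.Admissible) (x : Fin P.p₀) : ∃ y, y ≠ x := by
  have : Nontrivial (Fin P.p₀) := Fin.nontrivial_iff_two_le.mpr hP.two_le_p₀
  exact exists_ne x

theorem δ_add_δ_le (x : Fin P.p₀) {i i' : Fin (P.p x)} (h : i' ≠ i) :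
    P.δ x i + P.δ x i' ≤ P.δsum x := by
  rw [δsum, ← Finset.sum_pair h.symm]
  exact Finset.sum_le_sum_of_subset (Finset.subset_univ _)

theorem pγ_add_pγ_le {x y : Fin P.p₀} (h : y ≠ x) :
    P.p x * P.γ x + P.p y * P.γ y ≤ P.γsum := by
  rw [γsum, ← Finset.sum_pair (f := fun x => P.p x * P.γ x) h.symm]
  exact Finset.sum_le_sum_of_subset (Finset.subset_univ _)

theorem Admissible.nonempty_cauchyPoints (hP : P.Admissible) (F : Type*) [Fintype F]
    (hq : ∀ x i, P.n x i + P.δsum x + P.γsum - (P.p x - 2) * P.γ x ≤ Fintype.card F) :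
    Nonempty (P.CauchyPoints F) := by
  have h : ∀ x i, Nonempty ((P.Row x i ⊕ P.Col x i) ↪ F) := fun x i => by
    refine Function.Embedding.nonempty_of_card_le (le_trans ?_ (hq x i))
    have h₁ := P.card_otherδ_add x i
    have h₂ := P.card_otherγ_add x
    have h₃ := P.card_tailRow x i
    have h₄ := hP.k_lt_n x i
    obtain ⟨c, hc⟩ := Nat.exists_eq_add_of_le (hP.two_le_p x)
    have h₅ : P.p x * P.γ x = 2 * P.γ x + (P.p x - 2) * P.γ x := by
      rw [hc, Nat.add_sub_cancel_left, add_mul]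
    have h₆ : Fintype.card (P.Row x i) = P.k x i + (P.δ x i + 2 * P.γ x) := by
      rw [← h₃, Fintype.card_sum, Fintype.card_fin]
    have h₇ : Fintype.card (P.Col x i) = P.r x i +
        (Fintype.card (Σ i' : {i' : Fin (P.p x) // i' ≠ i}, Fin (P.δ x i'.1)) +
        Fintype.card (Σ y : {y : Fin P.p₀ // y ≠ x}, Fin (P.p y.1) × Fin (P.γ y.1))) := by
      rw [Fintype.card_sum, Fintype.card_sum, Fintype.card_fin]
    rw [Fintype.card_sum, h₆, h₇, r_eq]
    omega
  exact ⟨{ a := fun x i s => (h x i).some (Sum.inl s)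
           b := fun x i t => (h x i).some (Sum.inr t)
           distinct := fun x i => by
             convert (h x i).some.injective
             ext (s | t) <;> rfl }⟩

end Params

variable {F : Type*} [Field F] {P : Params}

namespace Params.CauchyPoints

variable (S : P.CauchyPoints F)

/-! ### Codewords as systematic words of the clouds -/

/-- The combination of the rows of `U_{x,i}` that the messages of the other clouds of the group
contribute to the cloud `(x, i)`. -/
def groupSyndrome (x : Fin P.p₀) (m : Word F (P.k x)) (i : Fin (P.p x)) : Fin (P.δ x i) → F :=
  fun t => ∑ i', if h : i ≠ i' then ∑ s, m i' s * S.B x i' i h s t else 0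

/-- The `i`-th of the vectors by which the messages of the other groups reach the group `x`: the
cloud `(x, i)` sees it together with its cyclic successor. -/
def crossSyndrome (m : HWord F P.k) (x : Fin P.p₀) (i : Fin (P.p x)) : Fin (P.γ x) → F :=
  fun t => ∑ y, if h : x ≠ y then ∑ j, ∑ s, m y j s * S.E y x j i h s t else 0

/-- The coefficients, with respect to the rows of `T_{x,i}`, of the parities of the cloud
`(x, i)`. -/
def coeff (m : HWord F P.k) (x : Fin P.p₀) (i : Fin (P.p x)) : P.Row x i → F :=
  Sum.elim (m x i) (Sum.elim (S.groupSyndrome x (m x) i)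
    (Sum.elim (S.crossSyndrome m x i) (S.crossSyndrome m x (finRotate _ i))))

theorem parity_same (x : Fin P.p₀) (i i' : Fin (P.p x)) :
    S.parity x x i i' = S.sameGroup x i i' := by
  simp [parity]

theorem parity_cross {x y : Fin P.p₀} (h : y ≠ x) (i : Fin (P.p x)) (j : Fin (P.p y)) :
    S.parity x y i j = S.crossGroup x y i j h := by
  simp [parity, h]

theorem sum_parity_same (m : HWord F P.k) (y : Fin P.p₀) (j : Fin (P.p y))
    (t : Fin (P.r y j)) :
    ∑ i, ∑ s, m y i s * S.parity y y i j s t = ∑ s, m y j s * S.T y j (Sum.inl s) (Sum.inl t) +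
      ∑ s, S.groupSyndrome y (m y) j s * S.T y j (Sum.inr (Sum.inl s)) (Sum.inl t) := by
  have hσ : ∀ u, S.groupSyndrome y (m y) j u =
      ∑ i : {i // i ≠ j}, ∑ s, m y i.1 s * S.B y i.1 j (Ne.symm i.2) s u := fun u => by
    rw [groupSyndrome, Fintype.sum_eq_add_sum_subtype_ne _ j]
    simp only [ne_eq, not_true_eq_false, dite_false, zero_add]
    exact Finset.sum_congr rfl fun i _ => dif_pos (Ne.symm i.2)
  have hU : ∀ s, S.T y j (Sum.inr (Sum.inl s)) (Sum.inl t) = S.U y j s t := fun s => rfl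
  simp only [hσ, hU]
  simp only [Finset.sum_mul (s := (Finset.univ : Finset {i // i ≠ j}))]
  rw [Finset.sum_comm (s := (Finset.univ : Finset (Fin (P.δ y j))))]
  refine (Fintype.sum_eq_add_sum_subtype_ne _ j).trans ?_
  simp only [parity_same]
  congr 1
  · simp [sameGroup, A]
  · refine Finset.sum_congr rfl fun i _ => ?_
    have hi : j ≠ i.1 := Ne.symm i.2
    simp only [sameGroup, hi, dite_false, Matrix.mul_apply, Finset.mul_sum, Finset.sum_mul]
    rw [Finset.sum_comm]
    simp only [mul_assoc]

theorem sum_parity_cross (m : HWord F P.k) {x y : Fin P.p₀} (h : y ≠ x) (j : Fin (P.p y))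
    (t : Fin (P.r y j)) :
    ∑ i, ∑ s, m x i s * S.parity x y i j s t =
      ∑ u, (∑ i, ∑ s, m x i s * S.E x y i j h s u) * S.V y j (Sum.inl u) t +
      ∑ u, (∑ i, ∑ s, m x i s * S.E x y i (finRotate _ j) h s u) * S.V y j (Sum.inr u) t := by
  simp only [S.parity_cross h, crossGroup, Matrix.mul_apply, Fintype.sum_sum_type,
    Matrix.fromCols_apply_inl, Matrix.fromCols_apply_inr, mul_add, Finset.mul_sum,
    Finset.sum_add_distrib, Finset.sum_mul, mul_assoc]
  congr 1
  · rw [Finset.sum_comm (γ := Fin (P.γ y))]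
    exact Finset.sum_congr rfl fun i _ => Finset.sum_comm
  · rw [Finset.sum_comm (γ := Fin (P.γ y))]
    exact Finset.sum_congr rfl fun i _ => Finset.sum_comm

theorem sum_parity (m : HWord F P.k) (y : Fin P.p₀) (j : Fin (P.p y)) (t : Fin (P.r y j)) :
    ∑ x, ∑ i, ∑ s, m x i s * S.parity x y i j s t =
      ∑ s, S.coeff m y j s * S.T y j s (Sum.inl t) := by
  rw [Fintype.sum_eq_add_sum_subtype_ne _ y, S.sum_parity_same]
  simp only [Fintype.sum_sum_type, coeff, Sum.elim_inl, Sum.elim_inr]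
  rw [add_assoc]
  congr 2
  have hE : ∀ j', ∀ u, S.crossSyndrome m y j' u =
      ∑ x : {x // x ≠ y}, ∑ i, ∑ s, m x.1 i s * S.E x.1 y i j' (Ne.symm x.2) s u := fun j' u => by
    rw [crossSyndrome, Fintype.sum_eq_add_sum_subtype_ne _ y]
    simp only [ne_eq, not_true_eq_false, dite_false, zero_add]
    exact Finset.sum_congr rfl fun x _ => dif_pos (Ne.symm x.2)
  simp only [hE, Finset.sum_mul (s := (Finset.univ : Finset {x // x ≠ y}))]
  rw [Finset.sum_comm (γ := Fin (P.γ y)), Finset.sum_comm (γ := Fin (P.γ y)),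
    ← Finset.sum_add_distrib]
  exact Finset.sum_congr rfl fun x _ => S.sum_parity_cross m (Ne.symm x.2) j t

/-- Collecting the products `B U` and `[E, E] V` by the rows of `U` and `V` turns the parities of
the generator matrix into combinations of the rows of `T_{y,j}`. -/
theorem mem_code {c : HWord F P.n} : c ∈ S.code ↔
    ∃ m : HWord F P.k, ∀ y j, c y j = systematicWord (r_eq y j) (S.T y j) (S.coeff m y j) := by
  have key : ∀ (m : HWord F P.k) y j t,
      Matrix.vecMul (fun s => m s.1 s.2.1 s.2.2) S.G ⟨y, j, t⟩ =
        systematicWord (r_eq y j) (S.T y j) (S.coeff m y j) t := fun m y j t => by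
    by_cases h : t.1 < P.k y j
    · rw [systematicWord_of_lt _ _ _ _ h]
      simp [Matrix.vecMul, dotProduct, G, h, coeff]
    · rw [systematicWord_of_not_lt _ _ _ _ h]
      refine Eq.trans ?_ (S.sum_parity m y j ⟨t.1 - P.k y j, _⟩)
      simp [Matrix.vecMul, dotProduct, G, h, Fintype.sum_sigma]
  constructor
  · rintro ⟨m, hm⟩
    exact ⟨fun x i s => m ⟨x, i, s⟩, fun y j => funext fun t => by rw [hm, ← key]⟩
  · rintro ⟨m, hm⟩
    exact ⟨fun s => m s.1 s.2.1 s.2.2, fun y j t => by rw [hm, key]⟩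

/-- The block `(x, i)` of the codeword with messages `m`. -/
def block (m : HWord F P.k) (x : Fin P.p₀) (i : Fin (P.p x)) : Fin (P.n x i) → F :=
  systematicWord (r_eq x i) (S.T x i) (S.coeff m x i)

/-! ### Syndromes of messages with few nonzero parts -/

theorem groupSyndrome_eq {x : Fin P.p₀} {w : Word F (P.k x)} {i i' : Fin (P.p x)} (h : i ≠ i')
    (hw : ∀ j, j ≠ i → j ≠ i' → w j = 0) (t : Fin (P.δ x i)) :
    S.groupSyndrome x w i t = ∑ s, w i' s * S.B x i' i h s t := by
  rw [groupSyndrome, Fintype.sum_eq_single i', dif_pos h]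
  intro j hj
  by_cases hji : i ≠ j
  · rw [dif_pos hji, hw j hji.symm hj]
    simp
  · rw [dif_neg hji]

theorem groupSyndrome_eq_zero {x : Fin P.p₀} {w : Word F (P.k x)} {i : Fin (P.p x)}
    (hw : ∀ j ≠ i, w j = 0) : S.groupSyndrome x w i = 0 := by
  funext t
  refine Finset.sum_eq_zero fun j _ => ?_
  by_cases hji : i ≠ j
  · rw [dif_pos hji, hw j hji.symm]
    simp
  · rw [dif_neg hji]

theorem crossSyndrome_eq {m : HWord F P.k} {x y : Fin P.p₀} (h : x ≠ y) {j : Fin (P.p y)}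
    (hm : ∀ z, z ≠ x → z ≠ y → m z = 0) (hmy : ∀ j' ≠ j, m y j' = 0) (i : Fin (P.p x))
    (t : Fin (P.γ x)) :
    S.crossSyndrome m x i t = ∑ s, m y j s * S.E y x j i h s t := by
  rw [crossSyndrome, Fintype.sum_eq_single y, dif_pos h, Fintype.sum_eq_single j]
  · intro j' hj'
    rw [hmy j' hj']
    simp
  · intro z hz
    by_cases hzx : x ≠ z
    · rw [dif_pos hzx, hm z hzx.symm hz]
      simp
    · rw [dif_neg hzx]

theorem crossSyndrome_eq_zero {m : HWord F P.k} {x : Fin P.p₀} (hm : ∀ z ≠ x, m z = 0)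
    (i : Fin (P.p x)) : S.crossSyndrome m x i = 0 := by
  funext t
  refine Finset.sum_eq_zero fun z _ => ?_
  by_cases hzx : x ≠ z
  · rw [dif_pos hzx, hm z hzx.symm]
    simp
  · rw [dif_neg hzx]

theorem coeff_eq_of_syndromes_eq_zero {m : HWord F P.k} {x : Fin P.p₀} {i : Fin (P.p x)}
    (h₁ : S.groupSyndrome x (m x) i = 0) (h₂ : ∀ j, S.crossSyndrome m x j = 0) :
    S.coeff m x i = Sum.elim (m x i) 0 := by
  rw [coeff, h₁, h₂, h₂]
  congr 1
  ext (s | s | s) <;> rfl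

theorem block_eq_zero {m : HWord F P.k} {x : Fin P.p₀} {i : Fin (P.p x)} (hm : m x i = 0)
    (h₁ : S.groupSyndrome x (m x) i = 0) (h₂ : ∀ j, S.crossSyndrome m x j = 0) :
    S.block m x i = 0 := by
  rw [block, S.coeff_eq_of_syndromes_eq_zero h₁ h₂, hm]
  convert map_zero (systematicWord (r_eq x i) (S.T x i))
  ext (s | s) <;> rfl

/-! ### The component codes -/

theorem mem_localCode {x : Fin P.p₀} {i : Fin (P.p x)} {v : Fin (P.n x i) → F} :
    v ∈ localCode (groupCode S.code x) i ↔ ∃ m, S.block m x i = v := by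
  constructor
  · rintro ⟨_, ⟨c, hc, rfl⟩, rfl⟩
    obtain ⟨m, hm⟩ := S.mem_code.mp hc
    exact ⟨m, (hm x i).symm⟩
  · rintro ⟨m, rfl⟩
    exact ⟨_, ⟨fun y j => S.block m y j, S.mem_code.mpr ⟨m, fun _ _ => rfl⟩, rfl⟩, rfl⟩

theorem mem_shortCode {x : Fin P.p₀} {i : Fin (P.p x)} {v : Fin (P.n x i) → F} :
    v ∈ shortCode (groupCode S.code x) i ↔
      ∃ m, (∀ j ≠ i, S.block m x j = 0) ∧ S.block m x i = v := by
  constructor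
  · rintro ⟨_, ⟨⟨c, hc, rfl⟩, h0⟩, rfl⟩
    obtain ⟨m, hm⟩ := S.mem_code.mp hc
    exact ⟨m, fun j hj => (hm x j).symm.trans (h0 j hj), (hm x i).symm⟩
  · rintro ⟨m, h0, rfl⟩
    exact ⟨_, ⟨⟨fun y j => S.block m y j, S.mem_code.mpr ⟨m, fun _ _ => rfl⟩, rfl⟩, h0⟩, rfl⟩

theorem mem_globalCode {x : Fin P.p₀} {i : Fin (P.p x)} {v : Fin (P.n x i) → F} :
    v ∈ globalCode S.code x i ↔
      ∃ m, ((∀ j ≠ i, S.block m x j = 0) ∧ ∀ y ≠ x, ∀ j, S.block m y j = 0) ∧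
        S.block m x i = v := by
  constructor
  · rintro ⟨c, hc, h0, rfl⟩
    obtain ⟨m, hm⟩ := S.mem_code.mp hc
    refine ⟨m, ⟨fun j hj => (hm x j).symm.trans (h0 x j ?_),
      fun y hy j => (hm y j).symm.trans (h0 y j ?_)⟩, (hm x i).symm⟩
    · rintro ⟨⟩
      exact hj rfl
    · rintro ⟨⟩
      exact hy rfl
  · rintro ⟨m, ⟨h0, h0'⟩, rfl⟩
    refine ⟨fun y j => S.block m y j, S.mem_code.mpr ⟨m, fun _ _ => rfl⟩, fun y j h => ?_, rfl⟩
    by_cases hy : y = x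
    · subst hy
      exact h0 j (by rintro rfl; exact h rfl)
    · exact h0' y hy j

theorem localCode_le (x : Fin P.p₀) (i : Fin (P.p x)) :
    localCode (groupCode S.code x) i ≤
      (constraintSpace (S.T x i) Finset.univ ∅).map (systematicWord (r_eq x i) (S.T x i)) := by
  intro v hv
  obtain ⟨m, rfl⟩ := S.mem_localCode.mp hv
  exact ⟨_, ⟨by simp, by simp⟩, rfl⟩

theorem sum_elim_zero_mul_T {ρ ι κ : Type*} [Fintype ρ] [Fintype ι] (a : ι → F)
    (T : Matrix (ι ⊕ ρ) κ F) (t : κ) :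
    ∑ s, Sum.elim a 0 s * T s t = ∑ s, a s * T (Sum.inl s) t := by
  simp

variable [DecidableEq F]

theorem block_eq_zero_iff (hP : P.Admissible) {m : HWord F P.k} {x : Fin P.p₀} {i : Fin (P.p x)} :
    S.block m x i = 0 ↔ S.coeff m x i = 0 :=
  map_eq_zero_iff _ (systematicWord_injective (r_eq x i) rfl (S.distinct x i)
    (hP.k_lt_n x i).le (hP.card_tailRow_le x i))

theorem eq_zero_of_block_eq_zero (hP : P.Admissible) {m : HWord F P.k} {x : Fin P.p₀}
    {i : Fin (P.p x)} (h : S.block m x i = 0) :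
    m x i = 0 ∧ S.groupSyndrome x (m x) i = 0 ∧ S.crossSyndrome m x i = 0 ∧
      S.crossSyndrome m x (finRotate _ i) = 0 := by
  have h := (S.block_eq_zero_iff hP).mp h
  exact ⟨funext fun s => congrFun h (Sum.inl s),
    funext fun s => congrFun h (Sum.inr (Sum.inl s)),
    funext fun s => congrFun h (Sum.inr (Sum.inr (Sum.inl s))),
    funext fun s => congrFun h (Sum.inr (Sum.inr (Sum.inr s)))⟩

/-- If the other blocks of its group vanish, then a cloud receives nothing from other clouds:
the two vectors that reach it from other groups also reach its cyclic neighbours. -/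
theorem syndromes_eq_zero_of_block_eq_zero (hP : P.Admissible) {m : HWord F P.k} {x : Fin P.p₀}
    {i : Fin (P.p x)} (h : ∀ j ≠ i, S.block m x j = 0) :
    S.groupSyndrome x (m x) i = 0 ∧ ∀ j, S.crossSyndrome m x j = 0 := by
  refine ⟨S.groupSyndrome_eq_zero fun j hj => (S.eq_zero_of_block_eq_zero hP (h j hj)).1,
    fun j => ?_⟩
  by_cases hj : j = i
  · subst hj
    have hne : (finRotate _).symm j ≠ j := fun he => by
      have := hP.finRotate_ne x j
      rw [← he, Equiv.apply_symm_apply] at this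
      exact this he.symm
    have := (S.eq_zero_of_block_eq_zero hP (h _ hne)).2.2.2
    rwa [Equiv.apply_symm_apply] at this
  · exact (S.eq_zero_of_block_eq_zero hP (h j hj)).2.2.1

/-- When the other clouds have long enough messages, the vectors that they contribute to a cloud
are arbitrary. -/
theorem localCode_eq (hP : P.Admissible) (x : Fin P.p₀) (i : Fin (P.p x))
    (hδ : ∀ i' ≠ i, P.δ x i ≤ P.k x i') (hγ : ∀ y ≠ x, ∀ j, 2 * P.γ x ≤ P.k y j) :
    localCode (groupCode S.code x) i =
      (constraintSpace (S.T x i) Finset.univ ∅).map (systematicWord (r_eq x i) (S.T x i)) := by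
  refine le_antisymm (S.localCode_le x i) ?_
  rintro _ ⟨v, -, rfl⟩
  obtain ⟨i', hi'⟩ := hP.exists_ne_cloud x i
  obtain ⟨y, hy⟩ := hP.exists_ne_group x
  let j : Fin (P.p y) := ⟨0, by have := hP.two_le_p y; omega⟩
  obtain ⟨u, hu⟩ := exists_sum_cauchy_eq (fun s : Fin (P.k x i') => S.a x i' (Sum.inl s))
    (fun t : Fin (P.δ x i) => S.b x i' (Sum.inr (Sum.inl ⟨⟨i, hi'.symm⟩, t⟩)))
    (by
      convert (S.distinct x i').comp (Function.Injective.sumMap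
        (f := fun s : Fin (P.k x i') => (Sum.inl s : P.Row x i'))
        (g := fun t : Fin (P.δ x i) => (Sum.inr (Sum.inl ⟨⟨i, hi'.symm⟩, t⟩) : P.Col x i'))
        (fun _ _ h => by simpa using h) (fun _ _ h => by simpa using h))
      ext (s | s) <;> rfl)
    (by simpa using hδ i' hi') (fun t => v (Sum.inr (Sum.inl t)))
  -- The two cross syndromes use disjoint sets of columns, because the cyclic successor of `i` is
  -- not `i`.
  let g : Fin (P.γ x) ⊕ Fin (P.γ x) → P.Col y j := Sum.elim
    (fun t => Sum.inr (Sum.inr ⟨⟨x, hy.symm⟩, (i, t)⟩))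
    (fun t => Sum.inr (Sum.inr ⟨⟨x, hy.symm⟩, (finRotate _ i, t)⟩))
  have hg : Function.Injective g := by
    have hne := hP.finRotate_ne x i
    rintro (s | s) (t | t) h <;> simp [g, hne, hne.symm, -finRotate_apply] at h ⊢ <;> exact h
  obtain ⟨w, hw⟩ := exists_sum_cauchy_eq (fun s : Fin (P.k y j) => S.a y j (Sum.inl s))
    (fun t => S.b y j (g t))
    (by
      convert (S.distinct y j).comp (Function.Injective.sumMap
        (f := fun s : Fin (P.k y j) => (Sum.inl s : P.Row y j))
        (fun _ _ h => by simpa using h) hg)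
      ext (s | s) <;> rfl)
    (by have := hγ y hy j; simp; omega) (fun t => v (Sum.inr (Sum.inr t)))
  -- The message of a second cloud of the group sets the group syndrome, that of a cloud of another
  -- group both cross syndromes; neither disturbs what the other two messages contribute.
  let m : HWord F P.k := Function.update (Pi.single y (Pi.single j w)) x
    (Function.update (Pi.single i' u) i fun s => v (Sum.inl s))
  have hmx : m x = Function.update (Pi.single i' u) i fun s => v (Sum.inl s) := by simp [m]
  have hmi : m x i = fun s => v (Sum.inl s) := by simp [hmx]
  have hmi' : m x i' = u := by simp [hmx, hi']
  have hmy : m y = Pi.single j w := by simp [m, hy]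
  refine S.mem_localCode.mpr ⟨m, congrArg (systematicWord (r_eq x i) (S.T x i)) (funext ?_)⟩
  have hcross := fun i₀ t => S.crossSyndrome_eq (m := m) hy.symm (j := j)
    (fun z hzx hzy => by simp [m, hzx, hzy]) (fun j' hj' => by simp [hmy, hj']) i₀ t
  simp only [hmy, Pi.single_eq_same] at hcross
  rintro (s | s | s | s)
  · exact congrFun hmi s
  · refine (S.groupSyndrome_eq hi'.symm (fun j hji hji' => ?_) s).trans ?_
    · simp [hmx, hji, hji']
    · rw [hmi']
      exact hu s
  · exact (hcross i s).trans (hw (Sum.inl s))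
  · exact (hcross (finRotate _ i) s).trans (hw (Sum.inr s))

/-- With no contribution from other clouds, the parities of the message on the columns of the
`B_{x,x;i,i'}` are the group syndromes of the other clouds, which have to vanish. -/
theorem shortCode_eq (hP : P.Admissible) (x : Fin P.p₀) (i : Fin (P.p x)) :
    shortCode (groupCode S.code x) i =
      (constraintSpace (S.T x i) ∅ (Finset.univ.map Function.Embedding.inl)).map
        (systematicWord (r_eq x i) (S.T x i)) := by
  ext v
  rw [S.mem_shortCode]
  constructor
  · rintro ⟨m, h0, rfl⟩
    obtain ⟨h₁, h₂⟩ := S.syndromes_eq_zero_of_block_eq_zero hP h0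
    have hc := S.coeff_eq_of_syndromes_eq_zero h₁ h₂
    refine ⟨S.coeff m x i, ?_, rfl⟩
    rw [hc]
    refine ⟨fun s _ => rfl, fun t ht => ?_⟩
    obtain ⟨⟨⟨i', hi'⟩, t⟩, -, rfl⟩ := Finset.mem_map.mp ht
    rw [sum_elim_zero_mul_T]
    have := S.eq_zero_of_block_eq_zero hP (h0 i' hi')
    exact (S.groupSyndrome_eq hi'
      (fun j _ hj => (S.eq_zero_of_block_eq_zero hP (h0 j hj)).1) t).symm.trans
      (congrFun this.2.1 t)
  · rintro ⟨v, ⟨hv, hv'⟩, rfl⟩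
    let m : HWord F P.k := Pi.single x (Pi.single i fun s => v (Sum.inl s))
    have hmx : m x = Pi.single i fun s => v (Sum.inl s) := by simp [m]
    have hv0 : v = Sum.elim (m x i) 0 := by
      ext (s | s)
      · simp [hmx]
      · exact hv s (Finset.notMem_empty s)
    have hcross : ∀ j, S.crossSyndrome m x j = 0 :=
      S.crossSyndrome_eq_zero fun z hz => by simp [m, hz]
    refine ⟨m, fun j hj => S.block_eq_zero (by simp [hmx, hj]) (funext fun t => ?_) hcross, ?_⟩
    · rw [S.groupSyndrome_eq hj (fun j' _ hj' => by simp [hmx, hj'])]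
      refine Eq.trans ?_ (hv' (Sum.inl ⟨⟨j, hj⟩, t⟩) (by simp))
      rw [hv0, sum_elim_zero_mul_T]
      rfl
    · rw [block, S.coeff_eq_of_syndromes_eq_zero
        (S.groupSyndrome_eq_zero fun j hj => by simp [hmx, hj]) hcross, hv0]

/-- As in `shortCode_eq`; in addition, the parities on the columns of the `E_{x,y;i;j}` are the
cross syndromes of the clouds of the other groups. -/
theorem globalCode_eq (hP : P.Admissible) (x : Fin P.p₀) (i : Fin (P.p x)) :
    globalCode S.code x i =
      (constraintSpace (S.T x i) ∅ Finset.univ).map (systematicWord (r_eq x i) (S.T x i)) := by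
  ext v
  rw [S.mem_globalCode]
  constructor
  · rintro ⟨m, ⟨h0, h0'⟩, rfl⟩
    obtain ⟨h₁, h₂⟩ := S.syndromes_eq_zero_of_block_eq_zero hP h0
    have hc := S.coeff_eq_of_syndromes_eq_zero h₁ h₂
    refine ⟨S.coeff m x i, ?_, rfl⟩
    rw [hc]
    refine ⟨fun s _ => rfl, fun t _ => ?_⟩
    rw [sum_elim_zero_mul_T]
    rcases t with ⟨⟨i', hi'⟩, t⟩ | ⟨⟨y, hy⟩, j, t⟩
    · have := S.eq_zero_of_block_eq_zero hP (h0 i' hi')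
      exact (S.groupSyndrome_eq hi'
        (fun j _ hj => (S.eq_zero_of_block_eq_zero hP (h0 j hj)).1) t).symm.trans
        (congrFun this.2.1 t)
    · have := S.eq_zero_of_block_eq_zero hP (h0' y hy j)
      exact (S.crossSyndrome_eq hy
        (fun z _ hz => funext fun j => (S.eq_zero_of_block_eq_zero hP (h0' z hz j)).1)
        (fun j hj => (S.eq_zero_of_block_eq_zero hP (h0 j hj)).1) j t).symm.trans
        (congrFun this.2.2.1 t)
  · rintro ⟨v, ⟨hv, hv'⟩, rfl⟩
    let m : HWord F P.k := Pi.single x (Pi.single i fun s => v (Sum.inl s))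
    have hmx : m x = Pi.single i fun s => v (Sum.inl s) := by simp [m]
    have hv0 : v = Sum.elim (m x i) 0 := by
      ext (s | s)
      · simp [hmx]
      · exact hv s (Finset.notMem_empty s)
    have hcross : ∀ j, S.crossSyndrome m x j = 0 :=
      S.crossSyndrome_eq_zero fun z hz => by simp [m, hz]
    refine ⟨m, ⟨fun j hj => S.block_eq_zero (by simp [hmx, hj]) (funext fun t => ?_) hcross,
      fun y hy j => ?_⟩, ?_⟩
    · rw [S.groupSyndrome_eq hj (fun j' _ hj' => by simp [hmx, hj'])]
      refine Eq.trans ?_ (hv' (Sum.inl ⟨⟨j, hj⟩, t⟩) (Finset.mem_univ _))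
      rw [hv0, sum_elim_zero_mul_T]
      rfl
    · have hmy : m y = 0 := by simp [m, hy]
      refine S.block_eq_zero (by rw [hmy]; rfl)
        (S.groupSyndrome_eq_zero fun j' _ => by rw [hmy]; rfl) fun j => funext fun t => ?_
      rw [S.crossSyndrome_eq hy (j := i) (fun z _ hz => by simp [m, hz])
        (fun j' hj' => by simp [hmx, hj'])]
      refine Eq.trans ?_ (hv' (Sum.inr ⟨⟨y, hy⟩, j, t⟩) (Finset.mem_univ _))
      rw [hv0, sum_elim_zero_mul_T]
      rfl
    · rw [block, S.coeff_eq_of_syndromes_eq_zero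
        (S.groupSyndrome_eq_zero fun j hj => by simp [hmx, hj]) hcross, hv0]

end Params.CauchyPoints

/-! ### Distances, dimensions and messages -/

namespace Params

theorem Admissible.d₁_add (hP : P.Admissible) (x : Fin P.p₀) (i : Fin (P.p x)) :
    P.d₁ x i + (P.δ x i + 2 * P.γ x) = P.r x i + 1 := by
  have := hP.two_γ_lt x i
  unfold d₁
  omega

theorem Admissible.d₂_add (hP : P.Admissible) (x : Fin P.p₀) (i : Fin (P.p x)) :
    P.d₂ x i + P.δ x i = P.r x i + P.δsum x + 1 := by
  have := hP.two_γ_lt x i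
  unfold d₂
  omega

theorem Admissible.d₃_add (hP : P.Admissible) (x : Fin P.p₀) (i : Fin (P.p x)) :
    P.d₃ x i + P.p x * P.γ x = P.d₂ x i + P.γsum := by
  have := hP.two_γ_lt x i
  have := P.card_otherγ_add x
  unfold d₃ d₂
  omega

theorem Admissible.d₁_lt_d₂ (hP : P.Admissible) (x : Fin P.p₀) (i : Fin (P.p x)) :
    P.d₁ x i < P.d₂ x i := by
  have := hP.d₁_add x i
  have := hP.d₂_add x i
  have := hP.γ_pos x
  omega

theorem Admissible.two_mul_γ_le (hP : P.Admissible) (x : Fin P.p₀) : 2 * P.γ x ≤ P.p x * P.γ x :=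
  Nat.mul_le_mul_right _ (hP.two_le_p x)

theorem Admissible.d₂_lt_d₃ (hP : P.Admissible) (x : Fin P.p₀) (i : Fin (P.p x)) :
    P.d₂ x i < P.d₃ x i := by
  have := hP.d₃_add x i
  obtain ⟨y, hy⟩ := hP.exists_ne_group x
  have := pγ_add_pγ_le hy
  have := hP.two_mul_γ_le y
  have := hP.γ_pos y
  omega

namespace CauchyPoints

variable (S : P.CauchyPoints F)

/-- The projection of a block to its first `k_{x,i}` coordinates. -/
def readMessage (hP : P.Admissible) (x : Fin P.p₀) (i : Fin (P.p x)) :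
    (Fin (P.n x i) → F) →ₗ[F] (Fin (P.k x i) → F) :=
  LinearMap.funLeft F F (Fin.castLE (hP.k_lt_n x i).le)

theorem readMessage_block (hP : P.Admissible) (m : HWord F P.k) (x : Fin P.p₀) (i : Fin (P.p x)) :
    readMessage hP x i (S.block m x i) = m x i :=
  funext fun s => systematicWord_of_lt (r_eq x i) _ _ (Fin.castLE (hP.k_lt_n x i).le s) s.2

variable [DecidableEq F]

/-- Each component code lies in an image of a constraint space: all tail rows are free in the local
code, while the `B`-parities vanish in the middle code and all tail parities in the global one. -/
theorem minDistGE_components (hP : P.Admissible) (x : Fin P.p₀) (i : Fin (P.p x)) :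
    MinDistGE (localCode (groupCode S.code x) i) (P.d₁ x i) ∧
      MinDistGE (shortCode (groupCode S.code x) i) (P.d₂ x i) ∧
      MinDistGE (globalCode S.code x i) (P.d₃ x i) := by
  have hkn := (hP.k_lt_n x i).le
  have h₁ := hP.d₁_add x i
  have h₂ := hP.d₂_add x i
  have h₃ := hP.d₃_add x i
  have hδ := P.card_otherδ_add x i
  have hγ := P.card_otherγ_add x
  have ht := P.card_tailRow x i
  rw [S.shortCode_eq hP, S.globalCode_eq hP]
  refine ⟨(minDistGE_systematicWord (r_eq x i) rfl (S.distinct x i) hkn _ _ ?_).mono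
      (S.localCode_le x i),
    minDistGE_systematicWord (r_eq x i) rfl (S.distinct x i) hkn _ _ ?_,
    minDistGE_systematicWord (r_eq x i) rfl (S.distinct x i) hkn _ _ ?_⟩
  · rw [Finset.card_univ, Finset.card_empty, ht]
    omega
  · rw [Finset.card_map, Finset.card_univ, Finset.card_empty]
    omega
  · rw [Finset.card_univ, Finset.card_empty, Fintype.card_sum]
    omega

/-- Under `d₃ ≤ n` the local code is the whole image too, so all three codes meet the Singleton
bound. -/
theorem exact_components (hP : P.Admissible) (hd : ∀ x i, P.d₃ x i ≤ P.n x i)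
    (x : Fin P.p₀) (i : Fin (P.p x)) :
    (HasMinDist (localCode (groupCode S.code x) i) (P.d₁ x i) ∧
      Module.finrank F (localCode (groupCode S.code x) i) = P.n x i - P.d₁ x i + 1) ∧
    (HasMinDist (shortCode (groupCode S.code x) i) (P.d₂ x i) ∧
      Module.finrank F (shortCode (groupCode S.code x) i) = P.n x i - P.d₂ x i + 1) ∧
    (HasMinDist (globalCode S.code x i) (P.d₃ x i) ∧
      Module.finrank F (globalCode S.code x i) = P.n x i - P.d₃ x i + 1) := by
  have hkn := (hP.k_lt_n x i).le
  have h₁ := hP.d₁_add x i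
  have h₂ := hP.d₂_add x i
  have h₃ := hP.d₃_add x i
  have h₁₂ := hP.d₁_lt_d₂ x i
  have h₂₃ := hP.d₂_lt_d₃ x i
  have hδ := P.card_otherδ_add x i
  have hγ := P.card_otherγ_add x
  have ht := P.card_tailRow x i
  have hρ := hP.card_tailRow_le x i
  have hn := hd x i
  -- `d₃ ≤ n` makes every message long enough to prescribe the syndromes of the other clouds.
  have hk : ∀ y j, P.δsum y + P.γsum < P.k y j + P.δ y j + P.p y * P.γ y := fun y j => by
    have := hd y j
    have := hP.d₂_add y j
    have := hP.d₃_add y j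
    have := r_eq y j
    have := hP.k_lt_n y j
    omega
  have hkδ : ∀ i' ≠ i, P.δ x i ≤ P.k x i' := fun i' hi' => by
    have := hk x i'
    have := δ_add_δ_le x hi'
    omega
  have hkγ : ∀ y ≠ x, ∀ j, 2 * P.γ x ≤ P.k y j := fun y hy j => by
    have := hk y j
    have := P.card_otherδ_add y j
    have := pγ_add_pγ_le hy
    have := hP.two_mul_γ_le x
    omega
  rw [S.shortCode_eq hP, S.globalCode_eq hP, S.localCode_eq hP x i hkδ hkγ]
  refine ⟨exact_systematicWord (r_eq x i) rfl (S.distinct x i) hkn hρ _ _ ?_ (by omega),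
    exact_systematicWord (r_eq x i) rfl (S.distinct x i) hkn hρ _ _ ?_ (by omega),
    exact_systematicWord (r_eq x i) rfl (S.distinct x i) hkn hρ _ _ ?_ hn⟩
  · rw [Finset.card_univ, Finset.card_empty, ht]
    omega
  · rw [Finset.card_map, Finset.card_univ, Finset.card_empty]
    omega
  · rw [Finset.card_univ, Finset.card_empty, Fintype.card_sum]
    omega

theorem isHierarchicalCode (hP : P.Admissible) (hd : ∀ x i, P.d₃ x i ≤ P.n x i) :
    IsHierarchicalCode P.n P.k ![P.d₁, P.d₂, P.d₃] S.code where
  D_lt₁ := hP.d₁_lt_d₂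
  D_lt₂ := hP.d₂_lt_d₃
  message := by
    refine ⟨readMessage hP, fun m => ⟨fun x i => S.block m x i,
      ⟨S.mem_code.mpr ⟨m, fun _ _ => rfl⟩, S.readMessage_block hP m⟩, ?_⟩⟩
    rintro c ⟨hc, hcm⟩
    obtain ⟨m', hm'⟩ := S.mem_code.mp hc
    have : m' = m := by
      ext x i : 2
      rw [← hcm, hm']
      exact (S.readMessage_block hP m' x i).symm
    subst this
    ext x i : 2
    exact hm' x i
  group x :=
    { k_lt_n := hP.k_lt_n x
      D_lt := hP.d₁_lt_d₂ x
      message := by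
        refine ⟨readMessage hP x, fun w => ⟨fun i => S.block (Pi.single x w) x i,
          ⟨fun y j => S.block (Pi.single x w) y j, S.mem_code.mpr ⟨_, fun _ _ => rfl⟩, rfl⟩,
          fun i => ?_⟩⟩
        rw [S.readMessage_block, Pi.single_eq_same]
      local_dist := fun i => (S.exact_components hP hd x i).1.1
      global_dist := fun i => (S.exact_components hP hd x i).2.1.1 }
  global_dist x i := (S.exact_components hP hd x i).2.2.1

end CauchyPoints

end Params

end HierCode

open HierCode in
theorem theorem1 (P : HierCode.Params) (hP : P.Admissible)
    (F : Type*) [Field F] [Fintype F] [DecidableEq F]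
    (hq : ∀ x i, P.n x i + P.δsum x + P.γsum - (P.p x - 2) * P.γ x ≤ Fintype.card F) :
    -- the distinct points that the construction needs exist
    Nonempty (P.CauchyPoints F) ∧
    ∀ S : P.CauchyPoints F,
      -- erasure correction at the three levels, for all parameters
      (∀ x i, MinDistGE (localCode (groupCode S.code x) i) (P.d₁ x i) ∧
        MinDistGE (shortCode (groupCode S.code x) i) (P.d₂ x i) ∧
        MinDistGE (globalCode S.code x i) (P.d₃ x i)) ∧
      -- exact distances, as soon as the block lengths admit the distances `d₃`
      ((∀ x i, P.d₃ x i ≤ P.n x i) →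
        IsHierarchicalCode P.n P.k ![P.d₁, P.d₂, P.d₃] S.code ∧
        -- the dimensions of the component codes
        ∀ x i,
          Module.finrank F (localCode (groupCode S.code x) i) = P.n x i - P.d₁ x i + 1 ∧
          Module.finrank F (shortCode (groupCode S.code x) i) = P.n x i - P.d₂ x i + 1 ∧
          Module.finrank F (globalCode S.code x i) = P.n x i - P.d₃ x i + 1) := by
  exact ⟨hP.nonempty_cauchyPoints F hq, fun S => ⟨S.minDistGE_components hP, fun hd =>
    ⟨S.isHierarchicalCode hP hd, fun x i =>
      ⟨(S.exact_components hP hd x i).1.2, (S.exact_components hP hd x i).2.1.2,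
        (S.exact_components hP hd x i).2.2.2⟩⟩⟩⟩
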